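/- Let $G=(V,E)$ be a finite connected simple graph. A connected spanning subgraph is a set $S\subseteq E$ such that $(V,S)$ is connected. For $x:E\to\mathbb R$ put $x(S)=\sum_{e\in S}x(e)$, and let $w^*(x)$ be the minimum of $x(S)$ over all connected spanning subgraphs $S$. A maxmin strategy is a probability distribution on $E$ that maximizes $w^*$ among all probability distributions on $E$. The pure best responses of the hider to $x$ are the connected spanning subgraphs $S$ with $x(S)=w^*(x)$. A prime strategy is a maxmin strategy for which the number of the hider's pure best responses is the minimum possible among all maxmin strategies. For $E'\subseteq E$ let $C(E')$ be the number of connected components of $(V,E\setminus E')$, and let $cr(E')=\frac{C(E')-C(\emptyset)}{|E'|}$ if $|V|>1$ and $E'\neq\emptyset$, and $cr(E')=0$ otherwise; let $opt=\max_{E'\subseteq E}cr(E')$. For a distribution $x$ let $\mathcal E(x)$ be the partition of $E$ into the nonempty sets on which $x$ takes a fixed value. The prime-partition $\mathcal P$ is the unique partition of $E$ that equals $\mathcal E(x)$ for some maxmin strategy $x$ and refines $\mathcal E(y)$ for every maxmin strategy $y$ (such a partition exists when $E\neq\emptyset$). The degenerate set $D$ is the (at most one) element of $\mathcal P$ on which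 every maxmin strategy is $0$; if there is none, $D=\emptyset$ and $\mathcal P\setminus\{D\}=\mathcal P$. An optimal connected spanning subgraph is a connected spanning subgraph $H$ with $|H\cap P|=|P|\cdot opt$ for every $P\in\mathcal P\setminus\{D\}$. For distinct $P,P'\in\mathcal P\setminus\{D\}$, $P$ leads to $P'$ if there are an optimal connected spanning subgraph $H$ and edges $e\in P\setminus H$, $e'\in P'\cap H$ such that $(H\setminus\{e'\})\cup\{e\}$ is a connected spanning subgraph; $P$ is a parent of $P'$ (and $P'$ a child of $P$) if $P$ leads to $P'$ and there is no $P''$ such that $P$ leads to $P''$ and $P''$ leads to $P'$. Let $\gamma$ be a maxmin strategy, and consider the condition $(*)$ $\gamma(e)>0$ for every $e\in E\setminus D$, and $\gamma(e)>\gamma(e')$ whenever $P$ is a parent of $P'$, $e\in P$ and $e'\in P'$. Then: 1. If $(*)$ holds, then $\gamma$ is a prime strategy. 2. If $opt<1$ (equivalently, $G$ has no bridge) and $\gamma$ is a prime strategy, then $(*)$ holds. Thus, when $opt<1$, $\gamma$ is a prime strategy if and only if $(*)$ holds. 3. If $\gamma$ is a prime strategy, then the hider's pure best responses to $\gamma$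 are exactly the optimal connected spanning subgraphs. -/

import Mathlib

/-! # The wiretap game on a graph

`G` is a finite graph, its edge set is the type `G.edgeSet`. A set of edges is a
`Finset G.edgeSet`, and a mixed strategy of the wiretapper is a point of
`stdSimplex ℝ G.edgeSet`, that is, a probability distribution on the edges. -/

namespace WiretapGame

noncomputable section

variable {V : Type*} [Fintype V] [DecidableEq V] (G : SimpleGraph V) [DecidableRel G.Adj]

/-- The spanning subgraph `(V, S)` of `G`. -/
def spanningSubgraph (S : Finset G.edgeSet) : SimpleGraph V :=
  SimpleGraph.fromEdgeSet (Subtype.val '' (S : Set G.edgeSet))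

/-- `S` is (the edge set of) a connected spanning subgraph: a pure strategy of the hider. -/
def IsCSG (S : Finset G.edgeSet) : Prop :=
  (spanningSubgraph G S).Connected

/-- The weight `x(S)`: the probability that the mixed strategy `x` of the wiretapper hits `S`. -/
def weight (x : G.edgeSet → ℝ) (S : Finset G.edgeSet) : ℝ :=
  ∑ e ∈ S, x e

/-- The weight of a minimum connected spanning subgraph of the graph `G` weighted by `x`.
(The infimum is over a finite set, which is nonempty when `G` is connected.) -/
def minWeight (x : G.edgeSet → ℝ) : ℝ :=
  ⨅ S : {S : Finset G.edgeSet // IsCSG G S}, weight G x S.1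

/-- Maxmin strategies of the wiretapper: the maximizers over `Δ(E)` of
`min_S x(S)`, where `S` ranges over the connected spanning subgraphs. -/
def IsMaxmin (x : G.edgeSet → ℝ) : Prop :=
  x ∈ stdSimplex ℝ G.edgeSet ∧ ∀ y ∈ stdSimplex ℝ G.edgeSet, minWeight G y ≤ minWeight G x

open Classical in
/-- The pure best responses of the hider against `x`. -/
def bestResponses (x : G.edgeSet → ℝ) : Finset (Finset G.edgeSet) :=
  {S | IsCSG G S ∧ weight G x S = minWeight G x}

/-- A maxmin strategy against which the number of the hider's pure best responses is the
minimum possible among maxmin strategies. -/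
def IsPrimeDist (x : G.edgeSet → ℝ) : Prop :=
  IsMaxmin G x ∧ ∀ y, IsMaxmin G y → (bestResponses G x).card ≤ (bestResponses G y).card

/-- The number of connected components of `(V, E \ A)`. -/
def numComponents (A : Finset G.edgeSet) : ℕ :=
  Nat.card (G.deleteEdges (Subtype.val '' (A : Set G.edgeSet))).ConnectedComponent

/-- The cut-rate of a set of edges. -/
def cutRate (A : Finset G.edgeSet) : ℝ :=
  if 1 < Fintype.card V ∧ 0 < A.card then
    ((numComponents G A : ℝ) - (numComponents G ∅ : ℝ)) / (A.card : ℝ)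
  else 0

/-- The cut-rate of the graph: the maximum of the cut-rates of its sets of edges. -/
def opt : ℝ :=
  (Finset.univ : Finset (Finset G.edgeSet)).sup' Finset.univ_nonempty (cutRate G)

/-- The partition of the edges into the sets on which `x` is constant, one for each value. -/
def levelPartition (x : G.edgeSet → ℝ) : Finset (Finset G.edgeSet) :=
  Finset.univ.image fun e => Finset.univ.filter fun f => x f = x e

/-- `pp` refines `qq`. -/
def Refines (pp qq : Finset (Finset G.edgeSet)) : Prop :=
  ∀ P ∈ pp, ∃ Q ∈ qq, P ⊆ Q

/-- `pp` is the level partition of some maxmin strategy and refines the level partition of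
every maxmin strategy. -/
def IsPrimePartition (pp : Finset (Finset G.edgeSet)) : Prop :=
  (∃ x, IsMaxmin G x ∧ levelPartition G x = pp) ∧
    ∀ y, IsMaxmin G y → Refines G pp (levelPartition G y)

open Classical in
/-- The prime-partition. It exists and is unique for a connected graph that has an edge, see
`existsUnique_isPrimePartition` and `isPrimePartition_primePartition`. -/
def primePartition : Finset (Finset G.edgeSet) :=
  if h : ∃ pp, IsPrimePartition G pp then h.choose else ∅

/-- `D` is an element of the prime-partition on which every maxmin strategy vanishes.
There is at most one such `D`, see `IsDegenerate.unique`. -/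
def IsDegenerate (D : Finset G.edgeSet) : Prop :=
  D ∈ primePartition G ∧ ∀ x, IsMaxmin G x → ∀ e ∈ D, x e = 0

open Classical in
/-- The degenerate set `D`, which is empty when no element of the prime-partition is degenerate. -/
def degenerateSet : Finset G.edgeSet :=
  if h : ∃ D, IsDegenerate G D then h.choose else ∅

/-- The elements of the prime-partition other than the degenerate set. (The elements of the
prime-partition are nonempty, so nothing is removed when the degenerate set is empty.) -/
def nondegenerateParts : Finset (Finset G.edgeSet) :=
  (primePartition G).erase (degenerateSet G)

/-- Optimal connected spanning subgraphs: connected spanning subgraphs `H` such that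
`|H ∩ P| = |P| * opt` for every nondegenerate element `P` of the prime-partition. -/
def IsOCSG (H : Finset G.edgeSet) : Prop :=
  IsCSG G H ∧ ∀ P ∈ nondegenerateParts G, ((H ∩ P).card : ℝ) = (P.card : ℝ) * opt G

/-- `P` leads to `P'`. -/
def LeadsTo (P P' : Finset G.edgeSet) : Prop :=
  P ∈ nondegenerateParts G ∧ P' ∈ nondegenerateParts G ∧ P ≠ P' ∧
    ∃ H, IsOCSG G H ∧ ∃ e ∈ P \ H, ∃ e' ∈ P' ∩ H, IsCSG G (insert e (H \ {e'}))

/-- `P` is a parent of `P'`, and `P'` a child of `P`. -/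
def IsParent (P P' : Finset G.edgeSet) : Prop :=
  LeadsTo G P P' ∧ ¬ ∃ P'', LeadsTo G P P'' ∧ LeadsTo G P'' P'

/-! ### The prime-partition exists and is unique -/

variable {G}

theorem isCSG_univ (hG : G.Connected) : IsCSG G Finset.univ := by
  have h : spanningSubgraph G Finset.univ = G := by
    simp [spanningSubgraph]
  rw [IsCSG, h]
  exact hG

theorem minWeight_le (x : G.edgeSet → ℝ) {S : Finset G.edgeSet} (hS : IsCSG G S) :
    minWeight G x ≤ weight G x S :=
  ciInf_le (Set.finite_range _).bddBelow (⟨S, hS⟩ : {S : Finset G.edgeSet // IsCSG G S})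

theorem exists_isMaxmin (hG : G.Connected) (hE : Nonempty G.edgeSet) : ∃ x, IsMaxmin G x := by
  classical
  have : Nonempty {S : Finset G.edgeSet // IsCSG G S} := ⟨⟨_, isCSG_univ hG⟩⟩
  have hc : Continuous (minWeight G) := by
    have h : minWeight G = fun x => (Finset.univ : Finset {S : Finset G.edgeSet // IsCSG G S}).inf'
        Finset.univ_nonempty (fun S => weight G x S.1) := by
      funext x
      rw [Finset.inf'_univ_eq_ciInf]
      rfl
    rw [h]
    refine Continuous.finset_inf'_apply _ fun S _ => ?_
    unfold weight
    fun_prop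
  obtain ⟨e⟩ := hE
  obtain ⟨x, hx, hmax⟩ := (isCompact_stdSimplex ℝ G.edgeSet).exists_isMaxOn
    ⟨_, single_mem_stdSimplex ℝ e⟩ hc.continuousOn
  exact ⟨x, hx, fun y hy => hmax hy⟩

theorem IsMaxmin.combo (hG : G.Connected) {x y : G.edgeSet → ℝ} (hx : IsMaxmin G x)
    (hy : IsMaxmin G y) {t : ℝ} (h0 : 0 ≤ t) (h1 : t ≤ 1) :
    IsMaxmin G ((1 - t) • x + t • y) := by
  have : Nonempty {S : Finset G.edgeSet // IsCSG G S} := ⟨⟨_, isCSG_univ hG⟩⟩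
  refine ⟨(convex_stdSimplex ℝ _) hx.1 hy.1 (by linarith) h0 (by ring), fun z hz => ?_⟩
  refine le_ciInf fun S => ?_
  have hw : weight G ((1 - t) • x + t • y) S.1 =
      (1 - t) * weight G x S.1 + t * weight G y S.1 := by
    simp [weight, Finset.sum_add_distrib, Finset.mul_sum]
  have hxS := (hx.2 z hz).trans (minWeight_le x S.2)
  have hyS := (hy.2 z hz).trans (minWeight_le y S.2)
  rw [hw]
  nlinarith [mul_le_mul_of_nonneg_left hxS (sub_nonneg.2 h1), mul_le_mul_of_nonneg_left hyS h0]

theorem refines_levelPartition_iff {x y : G.edgeSet → ℝ} :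
    Refines G (levelPartition G x) (levelPartition G y) ↔ ∀ e f, x e = x f → y e = y f := by
  constructor
  · intro h e f hef
    obtain ⟨Q, hQ, hsub⟩ := h _ (Finset.mem_image_of_mem _ (Finset.mem_univ f))
    obtain ⟨g, -, rfl⟩ := Finset.mem_image.1 hQ
    have h1 : y e = y g := by simpa using hsub (by simpa using hef)
    have h2 : y f = y g := by simpa using hsub (by simp : f ∈ _)
    rw [h1, h2]
  · intro h P hP
    obtain ⟨g, -, rfl⟩ := Finset.mem_image.1 hP
    refine ⟨_, Finset.mem_image_of_mem _ (Finset.mem_univ g), fun e he => ?_⟩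
    simp only [Finset.mem_filter, Finset.mem_univ, true_and] at he ⊢
    exact h e g he

theorem exists_isPrimePartition (hG : G.Connected) (hE : Nonempty G.edgeSet) :
    ∃ pp, IsPrimePartition G pp := by
  classical
  let d : (G.edgeSet → ℝ) → Finset (G.edgeSet × G.edgeSet) :=
    fun x => Finset.univ.filter fun p => x p.1 ≠ x p.2
  obtain ⟨x₀, hx₀⟩ := exists_isMaxmin hG hE
  obtain ⟨s, ⟨⟨x, hx, rfl⟩, hmax⟩⟩ :=
    (Set.toFinite (d '' {x | IsMaxmin G x})).exists_maximal ⟨_, x₀, hx₀, rfl⟩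
  refine ⟨_, ⟨x, hx, rfl⟩, fun y hy => refines_levelPartition_iff.2 fun e f hef => ?_⟩
  by_contra hne
  let bad : Set ℝ := ⋃ p : G.edgeSet × G.edgeSet,
    {t | x p.1 ≠ x p.2 ∧ (1 - t) * (x p.1 - x p.2) + t * (y p.1 - y p.2) = 0}
  have hbad : bad.Finite := by
    refine Set.finite_iUnion fun p => Set.Subsingleton.finite ?_
    rintro t ⟨hp, ht⟩ u ⟨-, hu⟩
    have hp' := sub_ne_zero.2 hp
    have h : (t - u) * (x p.1 - x p.2) = 0 := by
      linear_combination t * hu - u * ht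
    rcases mul_eq_zero.1 h with h | h
    · linarith
    · exact absurd h hp'
  obtain ⟨t, ht, htb⟩ := ((Set.Ioo_infinite (zero_lt_one (α := ℝ))).sdiff hbad).nonempty
  have hz := hx.combo hG hy ht.1.le ht.2.le
  have hle : d x ≤ d ((1 - t) • x + t • y) := by
    intro p hp
    simp only [d, Finset.mem_filter, Finset.mem_univ, true_and] at hp ⊢
    intro h
    refine htb (Set.mem_iUnion.2 ⟨p, hp, ?_⟩)
    simp only [Pi.add_apply, Pi.smul_apply, smul_eq_mul] at h
    linarith
  have hmem : (e, f) ∈ d ((1 - t) • x + t • y) := by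
    simp only [d, Finset.mem_filter, Finset.mem_univ, true_and, Pi.add_apply, Pi.smul_apply,
      smul_eq_mul, hef]
    intro h
    exact hne (mul_left_cancel₀ ht.1.ne' (by linarith))
  have := hmax ⟨_, hz, rfl⟩ hle hmem
  simp [d, hef] at this

theorem IsPrimePartition.unique {pp qq : Finset (Finset G.edgeSet)} (hpp : IsPrimePartition G pp)
    (hqq : IsPrimePartition G qq) : pp = qq := by
  obtain ⟨⟨x, hx, rfl⟩, hx'⟩ := hpp
  obtain ⟨⟨y, hy, rfl⟩, hy'⟩ := hqq
  have h (e f) : x e = x f ↔ y e = y f :=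
    ⟨refines_levelPartition_iff.1 (hx' y hy) e f, refines_levelPartition_iff.1 (hy' x hx) e f⟩
  simp [levelPartition, h]

theorem existsUnique_isPrimePartition (hG : G.Connected) (hE : Nonempty G.edgeSet) :
    ∃! pp, IsPrimePartition G pp := by
  obtain ⟨pp, h⟩ := exists_isPrimePartition hG hE
  exact ⟨pp, h, fun _ h' => h'.unique h⟩

theorem isPrimePartition_primePartition (hG : G.Connected) (hE : Nonempty G.edgeSet) :
    IsPrimePartition G (primePartition G) := by
  have h := exists_isPrimePartition hG hE
  rw [primePartition, dif_pos h]
  exact h.choose_spec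

theorem IsDegenerate.unique {D D' : Finset G.edgeSet} (hD : IsDegenerate G D)
    (hD' : IsDegenerate G D') : D = D' := by
  classical
  by_cases h : ∃ pp, IsPrimePartition G pp
  · have hp : IsPrimePartition G (primePartition G) := by
      rw [primePartition, dif_pos h]
      exact h.choose_spec
    obtain ⟨⟨x, hx, hxp⟩, -⟩ := hp
    have key : ∀ D, IsDegenerate G D → D = Finset.univ.filter fun f => x f = 0 := by
      intro D hD
      have hm := hD.1
      rw [← hxp] at hm
      obtain ⟨e, -, rfl⟩ := Finset.mem_image.1 hm
      have he : x e = 0 := hD.2 x hx e (by simp)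
      simp [he]
    rw [key D hD, key D' hD']
  · have := hD.1
    rw [primePartition, dif_neg h] at this
    simp at this

end

end WiretapGame

/-! Let c(A) be the number of components left after deleting A. Every connected spanning S has |S ∩
A| ≥ c(A) - 1. If T is an inclusion-minimal best response to a maxmin x and A is a superlevel set of
x, an exchange argument as in Kruskal's algorithm gives |T ∩ A| ≤ c(A) - 1 ≤ opt·|A|. Summed over
the layers of x, this bounds the value by opt, which the uniform distribution on a set of maximal
cut-rate attains. Equality in every layer makes each positive superlevel set tight and each best
response balanced on each positive level (`IsMaxmin.minWeight_eq_and_isTight`,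
`isBalanced_levelSet`).

Take a maxmin z of maximal support whose levels are the prime-partition. Its best responses are
exactly the optimal subgraphs, and these are best responses to every maxmin strategy. So a maxmin
strategy is prime iff it has the same best responses as z.

If γ satisfies the condition, any union of parts lying between {γ > c} and {γ ≥ c}, c > 0, is closed
under predecessors of `LeadsTo`, hence tight (`isTight_of_not_leadsTo`). Adding one part to the
smaller set, or removing it from the larger, bounds the share of a best response in that part from
both sides by opt. Conversely, an equality of γ along `LeadsTo`, or a zero on a nondegenerate part
when opt < 1, produces a best response to γ that is not one to z. -/

set_option linter.unusedSectionVars false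

namespace WiretapGame

/-! ### Component counts and edge exchange -/

section Connectivity

open Finset

variable {V : Type*} [Fintype V] [DecidableEq V] {G : SimpleGraph V} [DecidableRel G.Adj]

/-- The number of connected components of `(V, S)`. -/
noncomputable def componentCount (G : SimpleGraph V) [DecidableRel G.Adj]
    (S : Finset G.edgeSet) : ℕ :=
  Nat.card (spanningSubgraph G S).ConnectedComponent

/-- The end points of `e` lie in the same connected component of `(V, S)`. -/
def Spans (S : Finset G.edgeSet) (e : G.edgeSet) : Prop :=
  ∀ u v, e.1 = s(u, v) → (spanningSubgraph G S).Reachable u v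

theorem spanningSubgraph_adj {S : Finset G.edgeSet} {u v : V} :
    (spanningSubgraph G S).Adj u v ↔ ∃ e ∈ S, e.1 = s(u, v) := by
  simp only [spanningSubgraph, SimpleGraph.fromEdgeSet_adj, Set.mem_image, SetLike.mem_coe]
  constructor
  · rintro ⟨h, -⟩
    exact h
  · rintro ⟨e, he, h⟩
    refine ⟨⟨e, he, h⟩, ?_⟩
    have := e.2
    rw [h] at this
    exact G.ne_of_adj this

theorem spanningSubgraph_mono {S T : Finset G.edgeSet} (h : S ⊆ T) :
    spanningSubgraph G S ≤ spanningSubgraph G T := by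
  intro u v huv
  obtain ⟨e, he, heq⟩ := spanningSubgraph_adj.1 huv
  exact spanningSubgraph_adj.2 ⟨e, h he, heq⟩

theorem IsCSG.mono {S T : Finset G.edgeSet} (hS : IsCSG G S) (h : S ⊆ T) : IsCSG G T :=
  SimpleGraph.Connected.mono (spanningSubgraph_mono h) hS

theorem spans_of_mem {S : Finset G.edgeSet} {e : G.edgeSet} (he : e ∈ S) : Spans S e :=
  fun _ _ h => (spanningSubgraph_adj.2 ⟨e, he, h⟩).reachable

theorem Spans.mono {S T : Finset G.edgeSet} {e : G.edgeSet} (h : Spans S e) (hST : S ⊆ T) :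
    Spans T e :=
  fun u v huv => (h u v huv).mono (spanningSubgraph_mono hST)

theorem reachable_of_forall_spans {S T : Finset G.edgeSet} (h : ∀ e ∈ T, Spans S e) {u v : V}
    (huv : (spanningSubgraph G T).Reachable u v) : (spanningSubgraph G S).Reachable u v := by
  obtain ⟨p⟩ := huv
  induction p with
  | nil => rfl
  | cons hadj _ ih =>
    obtain ⟨e, he, heq⟩ := spanningSubgraph_adj.1 hadj
    exact (h e he _ _ heq).trans ih

theorem IsCSG.of_forall_spans {S T : Finset G.edgeSet} (hT : IsCSG G T)
    (h : ∀ e ∈ T, Spans S e) : IsCSG G S :=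
  have := hT.nonempty
  ⟨fun u v => reachable_of_forall_spans h (hT.preconnected u v)⟩

theorem componentCount_le_of_forall_spans {S T : Finset G.edgeSet} (h : ∀ e ∈ T, Spans S e) :
    componentCount G S ≤ componentCount G T := by
  classical
  refine Nat.card_le_card_of_surjective (SimpleGraph.ConnectedComponent.lift
    (fun v => (spanningSubgraph G S).connectedComponentMk v) ?_) ?_
  · intro u v p _
    exact SimpleGraph.ConnectedComponent.sound (reachable_of_forall_spans h ⟨p⟩)
  · intro c
    induction c using SimpleGraph.ConnectedComponent.ind with
    | h v => exact ⟨(spanningSubgraph G T).connectedComponentMk v, rfl⟩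

theorem componentCount_insert_lt {S : Finset G.edgeSet} {e : G.edgeSet} (h : ¬ Spans S e) :
    componentCount G (insert e S) < componentCount G S := by
  classical
  obtain ⟨u, v, huv, hnr⟩ : ∃ u v, e.1 = s(u, v) ∧ ¬ (spanningSubgraph G S).Reachable u v := by
    simpa [Spans] using h
  let φ : (spanningSubgraph G S).ConnectedComponent →
      (spanningSubgraph G (insert e S)).ConnectedComponent :=
    SimpleGraph.ConnectedComponent.map
      (SimpleGraph.Hom.ofLE (spanningSubgraph_mono (subset_insert e S)))
  have hsurj : Function.Surjective φ := by
    intro c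
    induction c using SimpleGraph.ConnectedComponent.ind with
    | h v => exact ⟨(spanningSubgraph G S).connectedComponentMk v, rfl⟩
  refine lt_of_le_of_ne (Nat.card_le_card_of_surjective φ hsurj) fun hcard => hnr ?_
  have hinj : Function.Injective φ :=
    ((Nat.bijective_iff_surjective_and_card φ).2 ⟨hsurj, hcard.symm⟩).1
  refine SimpleGraph.ConnectedComponent.exact (hinj ?_)
  exact SimpleGraph.ConnectedComponent.sound
    (spanningSubgraph_adj.2 ⟨e, mem_insert_self _ _, huv⟩).reachable

theorem reachable_insert {S : Finset G.edgeSet} {e : G.edgeSet} {u v : V} (he : e.1 = s(u, v))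
    {x y : V} (h : (spanningSubgraph G (insert e S)).Reachable x y) :
    (spanningSubgraph G S).Reachable x y ∨
      ((spanningSubgraph G S).Reachable x u ∨ (spanningSubgraph G S).Reachable x v) ∧
      ((spanningSubgraph G S).Reachable u y ∨ (spanningSubgraph G S).Reachable v y) := by
  obtain ⟨p⟩ := h
  induction p with
  | nil => exact Or.inl (SimpleGraph.Reachable.refl _)
  | @cons a b c hadj _ ih =>
    obtain ⟨f, hf, hfeq⟩ := spanningSubgraph_adj.1 hadj
    rcases mem_insert.1 hf with rfl | hf
    · rw [he, Sym2.eq_iff] at hfeq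
      refine Or.inr ?_
      have refl := fun w => SimpleGraph.Reachable.refl (G := spanningSubgraph G S) w
      rcases hfeq with ⟨rfl, rfl⟩ | ⟨rfl, rfl⟩
      · exact ⟨Or.inl (refl _), ih.elim Or.inr And.right⟩
      · exact ⟨Or.inr (refl _), ih.elim Or.inl And.right⟩
    · have hab : (spanningSubgraph G S).Reachable a b := spans_of_mem hf _ _ hfeq
      exact ih.imp hab.trans fun h => ⟨h.1.imp hab.trans hab.trans, h.2⟩

theorem componentCount_le_insert_add_one (S : Finset G.edgeSet) (e : G.edgeSet) :
    componentCount G S ≤ componentCount G (insert e S) + 1 := by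
  classical
  obtain ⟨u, v, huv⟩ : ∃ u v, e.1 = s(u, v) := ⟨_, _, (Quot.out_eq e.1).symm⟩
  set H := spanningSubgraph G S
  let φ : H.ConnectedComponent → Option (spanningSubgraph G (insert e S)).ConnectedComponent :=
    fun c => if c = H.connectedComponentMk u then none else
      some (c.map (SimpleGraph.Hom.ofLE (spanningSubgraph_mono (subset_insert e S))))
  have hinj : Function.Injective φ := by
    intro c d hcd
    by_cases hc : c = H.connectedComponentMk u <;> by_cases hd : d = H.connectedComponentMk u
    · rw [hc, hd]
    · simp [φ, hc, hd] at hcd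
    · simp [φ, hc, hd] at hcd
    · simp only [φ, hc, hd, if_false, Option.some.injEq] at hcd
      induction c using SimpleGraph.ConnectedComponent.ind with
      | h x =>
      induction d using SimpleGraph.ConnectedComponent.ind with
      | h y =>
      have hx : ¬ H.Reachable x u := fun h => hc (SimpleGraph.ConnectedComponent.sound h)
      have hy : ¬ H.Reachable y u := fun h => hd (SimpleGraph.ConnectedComponent.sound h)
      refine SimpleGraph.ConnectedComponent.sound ?_
      -- Neither vertex lies in the component of `u`, so a connection through `e` puts both in that
      -- of `v`.
      rcases reachable_insert huv (SimpleGraph.ConnectedComponent.exact hcd) with h | ⟨h1, h2⟩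
      · exact h
      · exact (h1.resolve_left hx).trans (h2.resolve_left fun h => hy h.symm)
  have := Nat.card_le_card_of_injective φ hinj
  rwa [Finite.card_option] at this

theorem componentCount_le_union_add_card (S B : Finset G.edgeSet) :
    componentCount G S ≤ componentCount G (S ∪ B) + B.card := by
  induction B using Finset.induction_on with
  | empty => simp
  | insert b B hb ih =>
    have h := componentCount_le_insert_add_one (S ∪ B) b
    rw [union_insert, card_insert_of_notMem hb]
    omega

theorem IsCSG.componentCount_eq_one {S : Finset G.edgeSet} (hS : IsCSG G S) :
    componentCount G S = 1 := by
  have := hS.nonempty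
  have := hS.preconnected.subsingleton_connectedComponent
  have : Nonempty (spanningSubgraph G S).ConnectedComponent :=
    ⟨(spanningSubgraph G S).connectedComponentMk (Classical.arbitrary V)⟩
  exact Nat.card_unique

theorem componentCount_pos [Nonempty V] (S : Finset G.edgeSet) : 0 < componentCount G S := by
  have : Nonempty (spanningSubgraph G S).ConnectedComponent :=
    ⟨(spanningSubgraph G S).connectedComponentMk (Classical.arbitrary V)⟩
  exact Nat.card_pos

theorem numComponents_eq (A : Finset G.edgeSet) : numComponents G A = componentCount G Aᶜ := by
  have h : G.deleteEdges (Subtype.val '' (A : Set G.edgeSet)) = spanningSubgraph G Aᶜ := by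
    ext u v
    rw [spanningSubgraph_adj, SimpleGraph.deleteEdges_adj]
    constructor
    · rintro ⟨huv, h⟩
      exact ⟨⟨s(u, v), huv⟩, mem_compl.2 fun hA => h ⟨_, hA, rfl⟩, rfl⟩
    · rintro ⟨e, he, heq⟩
      have h2 := e.2
      rw [heq] at h2
      refine ⟨h2, ?_⟩
      rintro ⟨f, hf, hfe⟩
      rw [← heq] at hfe
      exact mem_compl.1 he (Subtype.ext hfe ▸ hf)
  rw [numComponents, h, componentCount]

/-- Adding `S ∩ A` back to the complement of `A` restores connectivity, and each edge merges at most
two components. -/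
theorem IsCSG.numComponents_le {S : Finset G.edgeSet} (hS : IsCSG G S) (A : Finset G.edgeSet) :
    numComponents G A ≤ (S ∩ A).card + 1 := by
  have h := componentCount_le_union_add_card Aᶜ (S ∩ A)
  have h1 : IsCSG G (Aᶜ ∪ S ∩ A) := hS.mono fun e he => by
    by_cases hA : e ∈ A <;> simp [hA, he]
  rw [h1.componentCount_eq_one] at h
  rw [numComponents_eq]
  omega

/-- If each edge of `B`, added in turn, merged two components, the count would drop to zero. So some
edge is already spanned at its turn and is redundant. -/
theorem exists_isCSG_union_erase {S B : Finset G.edgeSet} (hSB : IsCSG G (S ∪ B))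
    (h : componentCount G S ≤ B.card) : ∃ b ∈ B, IsCSG G (S ∪ B.erase b) := by
  have := hSB.nonempty
  induction B using Finset.induction_on generalizing S with
  | empty =>
    have := componentCount_pos S
    rw [card_empty] at h
    omega
  | insert b B hb ih =>
    by_cases hs : Spans S b
    · refine ⟨b, mem_insert_self _ _, hSB.of_forall_spans fun e he => ?_⟩
      rw [erase_insert hb]
      rw [union_insert, mem_insert] at he
      rcases he with rfl | he
      · exact hs.mono subset_union_left
      · exact spans_of_mem he
    · have h1 := componentCount_insert_lt hs
      rw [card_insert_of_notMem hb] at h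
      obtain ⟨c, hc, h2⟩ := ih (S := insert b S) (by rwa [insert_union, ← union_insert])
        (by omega)
      refine ⟨c, mem_insert_of_mem hc, ?_⟩
      rwa [erase_insert_of_ne (by rintro rfl; exact hb hc), union_insert, ← insert_union]

/-- A connected spanning subgraph that is minimal under inclusion. -/
def IsMinimalCSG (G : SimpleGraph V) [DecidableRel G.Adj] (T : Finset G.edgeSet) : Prop :=
  Minimal (IsCSG G) T

/-- A minimal connected spanning subgraph with more edges in `A` than necessary can exchange an
edge of `A` for an edge outside `A`. -/
theorem IsMinimalCSG.exists_exchange {T A : Finset G.edgeSet} (hT : IsMinimalCSG G T)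
    (h : numComponents G A < (T ∩ A).card + 1) :
    ∃ e ∉ A, e ∉ T ∧ ∃ e' ∈ T ∩ A, IsCSG G (insert e (T \ {e'})) := by
  rw [numComponents_eq] at h
  have hT2 : T \ A ∪ T ∩ A = T := sdiff_union_inter T A
  -- Otherwise some edge of `T ∩ A` would be redundant, against minimality.
  have h1 : (T ∩ A).card < componentCount G (T \ A) := by
    by_contra! h1
    obtain ⟨b, hb, hcsg⟩ := exists_isCSG_union_erase (by rw [hT2]; exact hT.1) h1
    have hbT := (mem_inter.1 hb).1
    have hle : T \ A ∪ (T ∩ A).erase b ⊆ T :=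
      (union_subset_union_right (erase_subset _ _)).trans hT2.subset
    have := hT.2 hcsg hle hbT
    simp [(mem_inter.1 hb).2] at this
  -- The complement of `A` has at most `|T ∩ A|` components, fewer than `T \ A`, so it contains an
  -- edge joining two components of `T \ A`.
  obtain ⟨e, he, hne⟩ : ∃ e ∈ Aᶜ, ¬ Spans (T \ A) e := by
    by_contra! hall
    have := componentCount_le_of_forall_spans hall
    omega
  have heA := mem_compl.1 he
  have heT : e ∉ T := fun heT => hne (spans_of_mem (mem_sdiff.2 ⟨heT, heA⟩))
  have h2 := componentCount_insert_lt hne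
  -- `T \ A` has at most `|T ∩ A| + 1` components. After inserting `e` at most `|T ∩ A|` remain, so
  -- an edge of `T ∩ A` becomes redundant.
  have h3 := componentCount_le_union_add_card (T \ A) (T ∩ A)
  rw [hT2, IsCSG.componentCount_eq_one hT.1] at h3
  obtain ⟨e', he', hcsg⟩ := exists_isCSG_union_erase (S := insert e (T \ A)) (B := T ∩ A)
    (IsCSG.mono hT.1 (by rw [insert_union, hT2]; exact subset_insert _ _)) (by omega)
  refine ⟨e, heA, heT, e', he', hcsg.mono ?_⟩
  intro f hf
  simp only [mem_union, mem_insert, mem_sdiff, mem_erase, mem_inter, mem_singleton] at hf ⊢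
  rcases hf with (h | h) | h
  · exact Or.inl h
  · exact Or.inr ⟨h.1, fun hfe => h.2 (hfe ▸ (mem_inter.1 he').2)⟩
  · exact Or.inr ⟨h.2.1, h.1⟩

theorem numComponents_empty (hG : G.Connected) : numComponents G ∅ = 1 := by
  rw [numComponents_eq, compl_empty, (isCSG_univ hG).componentCount_eq_one]

end Connectivity

/-! ### The value of the game and balanced best responses -/

section Value

open Finset

/-- Summation by layers: the values of a nonnegative `x` are integrated over its superlevel sets. -/
theorem sum_mul_nonpos_of_superlevel {ι : Type*} [Fintype ι] (g : ι → ℝ) {x : ι → ℝ}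
    (hx : ∀ i, 0 ≤ x i) (hg : ∀ t > 0, ∑ i with t ≤ x i, g i ≤ 0) :
    ∑ i, x i * g i ≤ 0 ∧ (∑ i, x i * g i = 0 → ∀ t > 0, ∑ i with t ≤ x i, g i = 0) := by
  classical
  induction hn : (univ.filter fun i => 0 < x i).card using Nat.strong_induction_on
    generalizing x with
  | _ n ih =>
  subst hn
  rcases (univ.filter fun i => 0 < x i).eq_empty_or_nonempty with h0 | hne
  · have hx0 : ∀ i, x i = 0 := fun i => by
      have : i ∉ univ.filter fun i => 0 < x i := by simp [h0]
      exact le_antisymm (by simpa using this) (hx i)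
    refine ⟨by simp [hx0], fun _ t ht => ?_⟩
    simp [hx0, not_le.2 ht]
  · obtain ⟨j, hj, hmin⟩ := exists_min_image _ x hne
    simp only [mem_filter, mem_univ, true_and] at hj hmin
    set m := x j
    -- Peel off the bottom layer: lowering `x` by its least positive value shrinks the support and
    -- shifts the superlevel sets by `m`.
    let y : ι → ℝ := fun i => if 0 < x i then x i - m else 0
    have hy : ∀ i, 0 ≤ y i := fun i => by
      by_cases hi : 0 < x i
      · simpa [y, hi] using hmin i hi
      · simp [y, hi]
    have hlevel : ∀ t > 0, (univ.filter fun i => t ≤ y i) = univ.filter fun i => t + m ≤ x i := by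
      intro t ht
      ext i
      simp only [mem_filter, mem_univ, true_and, y]
      split_ifs with hi
      · exact le_sub_iff_add_le
      · constructor <;> intro h <;> linarith
    have hcard : (univ.filter fun i => 0 < y i).card < (univ.filter fun i => 0 < x i).card := by
      refine card_lt_card ((ssubset_iff_of_subset fun i hi => ?_).2 ⟨j, by simpa using hj, ?_⟩)
      · simp only [mem_filter, mem_univ, true_and, y] at hi ⊢
        by_contra h
        simp [h] at hi
      · simp [y, m]
    obtain ⟨h1, h2⟩ := ih _ hcard hy
      (fun t ht => by rw [hlevel t ht]; exact hg _ (by linarith)) rfl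
    have hsupp : (univ.filter fun i => m ≤ x i) = univ.filter fun i => 0 < x i := by
      ext i
      simp only [mem_filter, mem_univ, true_and]
      exact ⟨hj.trans_le, hmin i⟩
    have hsum : ∑ i, x i * g i = m * ∑ i with m ≤ x i, g i + ∑ i, y i * g i := by
      rw [hsupp, sum_filter, mul_sum, ← sum_add_distrib]
      refine sum_congr rfl fun i _ => ?_
      by_cases hi : 0 < x i
      · simp only [hi, if_true, y]
        ring
      · simp [y, le_antisymm (not_lt.1 hi) (hx i)]
    have h3 : m * ∑ i with m ≤ x i, g i ≤ 0 := mul_nonpos_of_nonneg_of_nonpos hj.le (hg m hj)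
    refine ⟨by linarith, fun h t ht => ?_⟩
    rcases le_or_gt t m with htm | htm
    · have : (univ.filter fun i => t ≤ x i) = univ.filter fun i => m ≤ x i := by
        rw [hsupp]
        ext i
        simp only [mem_filter, mem_univ, true_and]
        exact ⟨ht.trans_le, fun hi => htm.trans (hmin i hi)⟩
      rw [this]
      exact (mul_eq_zero.1 (by linarith)).resolve_left hj.ne'
    · have := h2 (by linarith) (t - m) (by linarith)
      rwa [hlevel _ (by linarith), sub_add_cancel] at this

variable {V : Type*} [Fintype V] [DecidableEq V] {G : SimpleGraph V} [DecidableRel G.Adj]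

theorem mem_bestResponses {x : G.edgeSet → ℝ} {S : Finset G.edgeSet} :
    S ∈ bestResponses G x ↔ IsCSG G S ∧ weight G x S = minWeight G x := by
  simp [bestResponses]

theorem mem_bestResponses_of_le {x : G.edgeSet → ℝ} {S : Finset G.edgeSet} (hS : IsCSG G S)
    (h : weight G x S ≤ minWeight G x) : S ∈ bestResponses G x :=
  mem_bestResponses.2 ⟨hS, h.antisymm (minWeight_le x hS)⟩

theorem bestResponses_nonempty (hG : G.Connected) (x : G.edgeSet → ℝ) :
    (bestResponses G x).Nonempty := by
  have : Nonempty {S : Finset G.edgeSet // IsCSG G S} := ⟨⟨_, isCSG_univ hG⟩⟩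
  obtain ⟨S, hS⟩ := exists_eq_ciInf_of_finite
    (f := fun S : {S : Finset G.edgeSet // IsCSG G S} => weight G x S.1)
  exact ⟨S.1, mem_bestResponses.2 ⟨S.2, hS⟩⟩

/-- A best response of least cardinality works: weights are nonnegative, so a connected spanning
subset of it is again a best response. -/
theorem exists_isMinimalCSG_mem_bestResponses (hG : G.Connected) {x : G.edgeSet → ℝ}
    (hx : ∀ e, 0 ≤ x e) : ∃ T ∈ bestResponses G x, IsMinimalCSG G T := by
  obtain ⟨T, hT, hmin⟩ := exists_min_image _ card (bestResponses_nonempty hG x)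
  obtain ⟨hcsg, hw⟩ := mem_bestResponses.1 hT
  refine ⟨T, hT, hcsg, fun S hS hST => ?_⟩
  have h : S ∈ bestResponses G x := mem_bestResponses_of_le hS <| by
    rw [← hw]
    exact sum_le_sum_of_subset_of_nonneg hST fun e _ _ => hx e
  exact (eq_of_subset_of_card_le hST (hmin S h)).ge

theorem weight_exchange (x : G.edgeSet → ℝ) {T : Finset G.edgeSet} {e e' : G.edgeSet}
    (he : e ∉ T) (he' : e' ∈ T) :
    weight G x (insert e (T \ {e'})) = weight G x T + x e - x e' := by
  have h : e ∉ T \ {e'} := fun h => he (mem_sdiff.1 h).1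
  rw [weight, sum_insert h, weight, ← sum_sdiff (singleton_subset_iff.2 he'), sum_singleton]
  ring

theorem le_of_mem_bestResponses {x : G.edgeSet → ℝ} {T : Finset G.edgeSet}
    (hT : T ∈ bestResponses G x) {e e' : G.edgeSet} (he : e ∉ T) (he' : e' ∈ T)
    (h : IsCSG G (insert e (T \ {e'}))) : x e' ≤ x e := by
  have h1 := minWeight_le x h
  rw [weight_exchange x he he', ← (mem_bestResponses.1 hT).2] at h1
  linarith

theorem exchange_mem_bestResponses {x : G.edgeSet → ℝ} {T : Finset G.edgeSet}
    (hT : T ∈ bestResponses G x) {e e' : G.edgeSet} (he : e ∉ T) (he' : e' ∈ T)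
    (h : IsCSG G (insert e (T \ {e'}))) (hx : x e = x e') :
    insert e (T \ {e'}) ∈ bestResponses G x := by
  refine mem_bestResponses.2 ⟨h, ?_⟩
  rw [weight_exchange x he he', (mem_bestResponses.1 hT).2, hx, add_sub_cancel_right]

theorem cutRate_le_opt (A : Finset G.edgeSet) : cutRate G A ≤ opt G :=
  le_sup' (cutRate G) (mem_univ A)

theorem one_lt_card_of_edge (e : G.edgeSet) : 1 < Fintype.card V := by
  obtain ⟨⟨u, v⟩, he⟩ := e
  exact Fintype.one_lt_card_iff.2 ⟨u, v, G.ne_of_adj he⟩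

theorem cutRate_of_mem (hG : G.Connected) {A : Finset G.edgeSet} {e : G.edgeSet} (he : e ∈ A) :
    cutRate G A = ((numComponents G A : ℝ) - 1) / A.card := by
  rw [cutRate, if_pos ⟨one_lt_card_of_edge e, card_pos.2 ⟨e, he⟩⟩, numComponents_empty hG,
    Nat.cast_one]

theorem numComponents_le_opt (hG : G.Connected) (A : Finset G.edgeSet) :
    (numComponents G A : ℝ) - 1 ≤ opt G * A.card := by
  rcases A.eq_empty_or_nonempty with rfl | ⟨e, he⟩
  · simp [numComponents_empty hG]
  · have h := cutRate_le_opt A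
    rwa [cutRate_of_mem hG he, div_le_iff₀ (by exact_mod_cast card_pos.2 ⟨e, he⟩)] at h

theorem opt_pos (hG : G.Connected) (e : G.edgeSet) : 0 < opt G := by
  have := hG.nonempty
  refine lt_of_lt_of_le ?_ (cutRate_le_opt univ)
  have hs : ¬ Spans (∅ : Finset G.edgeSet) e := by
    obtain ⟨⟨u, v⟩, he⟩ := e
    intro h
    have hbot : spanningSubgraph G ∅ = ⊥ := by simp [spanningSubgraph]
    have h2 := h u v rfl
    rw [hbot] at h2
    exact G.ne_of_adj he (SimpleGraph.reachable_bot.1 h2)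
  have h1 := componentCount_insert_lt hs
  have h2 := componentCount_pos (insert e (∅ : Finset G.edgeSet))
  rw [cutRate_of_mem hG (mem_univ e), numComponents_eq, compl_univ]
  refine div_pos (sub_pos.2 ?_) (by exact_mod_cast card_pos.2 ⟨e, mem_univ e⟩)
  exact_mod_cast (show 1 < componentCount G ∅ by omega)

/-- Every connected spanning subgraph uses at least the fraction `opt` of the edges in `A`. -/
def IsTight (G : SimpleGraph V) [DecidableRel G.Adj] (A : Finset G.edgeSet) : Prop :=
  ∀ S, IsCSG G S → opt G * A.card ≤ (S ∩ A).card

theorem weight_ite_mem (A S : Finset G.edgeSet) (c : ℝ) :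
    weight G (fun e => if e ∈ A then c else 0) S = (S ∩ A).card * c := by
  rw [weight, ← sum_filter, sum_const, nsmul_eq_mul, filter_mem_eq_inter]

theorem le_minWeight (hG : G.Connected) {x : G.edgeSet → ℝ} {c : ℝ}
    (h : ∀ S, IsCSG G S → c ≤ weight G x S) : c ≤ minWeight G x := by
  obtain ⟨S, hS⟩ := bestResponses_nonempty hG x
  rw [← (mem_bestResponses.1 hS).2]
  exact h S (mem_bestResponses.1 hS).1

/-- The witness is the uniform distribution on a set of maximal cut-rate. -/
theorem exists_opt_le_minWeight (hG : G.Connected) (e : G.edgeSet) :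
    ∃ x ∈ stdSimplex ℝ G.edgeSet, opt G ≤ minWeight G x := by
  obtain ⟨A, -, hA⟩ := exists_mem_eq_sup' univ_nonempty (cutRate G)
  change opt G = cutRate G A at hA
  have hpos := opt_pos hG e
  obtain ⟨f, hf⟩ : A.Nonempty := by
    rw [nonempty_iff_ne_empty]
    rintro rfl
    simp [hA, cutRate] at hpos
  have hc : (0 : ℝ) < A.card := by exact_mod_cast card_pos.2 ⟨f, hf⟩
  refine ⟨fun e => if e ∈ A then (A.card : ℝ)⁻¹ else 0, ⟨fun e => ?_, ?_⟩,
    le_minWeight hG fun S hS => ?_⟩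
  · dsimp only
    split_ifs <;> positivity
  · have := weight_ite_mem A univ (A.card : ℝ)⁻¹
    rw [univ_inter, mul_inv_cancel₀ hc.ne'] at this
    exact this
  · rw [weight_ite_mem, hA, cutRate_of_mem hG hf, ← div_eq_mul_inv]
    have : (numComponents G A : ℝ) ≤ (S ∩ A).card + 1 := by exact_mod_cast hS.numComponents_le A
    gcongr
    linarith

theorem sum_ite_mem_sub (A S : Finset G.edgeSet) (c : ℝ) :
    ∑ e ∈ A, ((if e ∈ S then 1 else 0) - c) = (S ∩ A).card - c * A.card := by
  rw [sum_sub_distrib, sum_boole, sum_const, nsmul_eq_mul, mul_comm c, filter_mem_eq_inter,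
    inter_comm]

theorem sum_mul_ite_mem_sub (x : G.edgeSet → ℝ) (S : Finset G.edgeSet) (c : ℝ) :
    ∑ e, x e * ((if e ∈ S then 1 else 0) - c) = weight G x S - c * ∑ e, x e := by
  simp [mul_sub, sum_sub_distrib, weight, ← sum_mul, mul_comm c]

theorem nonempty_edgeSet_of_isMaxmin {x : G.edgeSet → ℝ} (hx : IsMaxmin G x) :
    Nonempty G.edgeSet := by
  by_contra h
  rw [not_nonempty_iff] at h
  simpa using hx.1.2

theorem IsMaxmin.minWeight_eq_and_isTight (hG : G.Connected) {x : G.edgeSet → ℝ}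
    (hx : IsMaxmin G x) : minWeight G x = opt G ∧
      ∀ t > 0, IsTight G (univ.filter fun e => t ≤ x e) := by
  obtain ⟨e⟩ := nonempty_edgeSet_of_isMaxmin hx
  obtain ⟨y, hy, hopt⟩ := exists_opt_le_minWeight hG e
  have hle := hopt.trans (hx.2 y hy)
  obtain ⟨T, hT, hmin⟩ := exists_isMinimalCSG_mem_bestResponses hG hx.1.1
  -- Otherwise an edge of weight at least `t` could be exchanged for one of weight below `t`, making
  -- `T` lighter.
  have hgreedy : ∀ t, (T ∩ univ.filter fun e => t ≤ x e).card + 1 ≤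
      numComponents G (univ.filter fun e => t ≤ x e) := by
    intro t
    by_contra! h
    obtain ⟨e, he, heT, e', he', hcsg⟩ := hmin.exists_exchange h
    have h1 := le_of_mem_bestResponses hT heT (mem_inter.1 he').1 hcsg
    simp only [mem_inter, mem_filter, mem_univ, true_and] at he he'
    exact he (he'.2.trans h1)
  have hgreedy' : ∀ t, ((T ∩ univ.filter fun e => t ≤ x e).card : ℝ) + 1 ≤
      numComponents G (univ.filter fun e => t ≤ x e) := fun t => by exact_mod_cast hgreedy t
  obtain ⟨h1, h2⟩ := sum_mul_nonpos_of_superlevel (fun e => (if e ∈ T then 1 else 0) - opt G)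
    hx.1.1 fun t _ => by
      rw [sum_ite_mem_sub]
      linarith [hgreedy' t, numComponents_le_opt hG (univ.filter fun e => t ≤ x e)]
  rw [sum_mul_ite_mem_sub, hx.1.2, (mem_bestResponses.1 hT).2, mul_one] at h1 h2
  refine ⟨by linarith, fun t ht S hS => ?_⟩
  -- The total is both at most and at least `opt`, so every layer is an equality, which passes from
  -- `T` to any `S` through the component count.
  have h3 := h2 (by linarith) t ht
  rw [sum_ite_mem_sub] at h3
  have h4 : (numComponents G (univ.filter fun e => t ≤ x e) : ℝ) ≤
      (S ∩ univ.filter fun e => t ≤ x e).card + 1 := by exact_mod_cast hS.numComponents_le _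
  linarith [hgreedy' t]

/-- `S` contains exactly the fraction `opt` of the edges in `A`. -/
def IsBalanced (S A : Finset G.edgeSet) : Prop :=
  ((S ∩ A).card : ℝ) = opt G * A.card

/-- Tightness gives one inequality in each layer, and the weight of a best response is exactly
`opt`, so the layer sum forces equality throughout. -/
theorem isBalanced_superlevel (hG : G.Connected) {x : G.edgeSet → ℝ} (hx : IsMaxmin G x)
    {S : Finset G.edgeSet} (hS : S ∈ bestResponses G x) {t : ℝ} (ht : 0 < t) :
    IsBalanced S (univ.filter fun e => t ≤ x e) := by
  obtain ⟨hval, htight⟩ := hx.minWeight_eq_and_isTight hG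
  obtain ⟨hcsg, hw⟩ := mem_bestResponses.1 hS
  have hsum : ∀ A : Finset G.edgeSet, ∑ e ∈ A, -((if e ∈ S then 1 else 0) - opt G) =
      opt G * A.card - (S ∩ A).card := fun A => by
    rw [sum_neg_distrib, sum_ite_mem_sub, neg_sub]
  have h := (sum_mul_nonpos_of_superlevel (fun e => -((if e ∈ S then 1 else 0) - opt G))
    hx.1.1 fun t ht => by
      rw [hsum]
      linarith [htight t ht S hcsg]).2
  simp only [mul_neg, sum_neg_distrib (f := fun e => x e * _)] at h
  rw [sum_mul_ite_mem_sub, hx.1.2, hw, hval, mul_one, sub_self, neg_zero] at h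
  have h1 := h rfl t ht
  rw [hsum] at h1
  exact (sub_eq_zero.1 h1).symm

theorem IsBalanced.sdiff {S A B : Finset G.edgeSet} (hA : IsBalanced S A) (hB : IsBalanced S B)
    (h : B ⊆ A) : IsBalanced S (A \ B) := by
  have h1 := card_sdiff_add_card_eq_card h
  have h2 := card_sdiff_add_card_eq_card (inter_subset_inter_left h : S ∩ B ⊆ S ∩ A)
  have h3 : S ∩ (A \ B) = (S ∩ A) \ (S ∩ B) := by
    ext e
    simp only [mem_inter, mem_sdiff]
    tauto
  rw [IsBalanced, ← h2, ← h1, ← h3] at hA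
  rw [IsBalanced] at hB ⊢
  push_cast at hA
  linarith

theorem isBalanced_strict_superlevel (hG : G.Connected) {x : G.edgeSet → ℝ} (hx : IsMaxmin G x)
    {S : Finset G.edgeSet} (hS : S ∈ bestResponses G x) {t : ℝ} (ht : 0 < t) :
    IsBalanced S (univ.filter fun e => t < x e) := by
  rcases (univ.filter fun e => t < x e).eq_empty_or_nonempty with h0 | hne
  · simp [h0, IsBalanced]
  · obtain ⟨j, hj, hmin⟩ := exists_min_image _ x hne
    simp only [mem_filter, mem_univ, true_and] at hj hmin
    -- A nonempty strict superlevel set is the weak superlevel set at the next larger value of `x`.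
    convert isBalanced_superlevel hG hx hS (ht.trans hj) using 1
    ext e
    simp only [mem_filter, mem_univ, true_and]
    exact ⟨hmin e, hj.trans_le⟩

/-- The edges on which `x` takes the same value as on `e`. -/
noncomputable def levelSet (x : G.edgeSet → ℝ) (e : G.edgeSet) : Finset G.edgeSet :=
  univ.filter fun f => x f = x e

theorem mem_levelSet {x : G.edgeSet → ℝ} {e f : G.edgeSet} : f ∈ levelSet x e ↔ x f = x e := by
  simp [levelSet]

theorem isBalanced_levelSet (hG : G.Connected) {x : G.edgeSet → ℝ} (hx : IsMaxmin G x)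
    {S : Finset G.edgeSet} (hS : S ∈ bestResponses G x) {e : G.edgeSet} (he : 0 < x e) :
    IsBalanced S (levelSet x e) := by
  convert (isBalanced_superlevel hG hx hS he).sdiff (isBalanced_strict_superlevel hG hx hS he)
    fun f hf => ?_ using 1
  · ext f
    simp only [mem_levelSet, mem_sdiff, mem_filter, mem_univ, true_and, not_lt]
    exact ⟨fun h => ⟨h.ge, h.le⟩, fun h => h.2.antisymm h.1⟩
  · simp only [mem_filter, mem_univ, true_and] at hf ⊢
    exact hf.le

/-- A set that is balanced on the positive levels of `z` has weight `opt * ∑ y` for every `y` that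
is a function of `z` vanishing where `z` does. -/
theorem weight_eq_of_isBalanced {z y : G.edgeSet → ℝ} (hz : ∀ e, 0 ≤ z e)
    (hzy : ∀ e f, z e = z f → y e = y f) (h0 : ∀ e, z e = 0 → y e = 0) {S : Finset G.edgeSet}
    (hS : ∀ e, 0 < z e → IsBalanced S (levelSet z e)) : weight G y S = opt G * ∑ e, y e := by
  rw [← sub_eq_zero, ← sum_mul_ite_mem_sub,
    ← sum_fiberwise_of_maps_to (g := z) fun e _ => mem_image_of_mem z (mem_univ e)]
  refine sum_eq_zero fun v hv => ?_
  obtain ⟨e, -, rfl⟩ := mem_image.1 hv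
  rcases (hz e).eq_or_lt with he | he
  · refine sum_eq_zero fun f hf => ?_
    rw [h0 f ((mem_filter.1 hf).2.trans he.symm), zero_mul]
  · have h1 := hS e he
    rw [IsBalanced, ← sub_eq_zero, ← sum_ite_mem_sub, levelSet] at h1
    refine Eq.trans ?_ ((congrArg (y e * ·) h1).trans (mul_zero _))
    simp only [mul_sum]
    refine sum_congr rfl fun f hf => ?_
    rw [hzy f e (mem_filter.1 hf).2]

end Value

/-! ### Representatives of the prime-partition -/

section PrimePartition

open Finset

variable {V : Type*} [Fintype V] [DecidableEq V] {G : SimpleGraph V} [DecidableRel G.Adj]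

/-- A maxmin strategy of maximal support whose levels form the prime-partition. -/
structure IsPrimeRep (z : G.edgeSet → ℝ) : Prop where
  isMaxmin : IsMaxmin G z
  levelPartition_eq : levelPartition G z = primePartition G
  eq_zero : ∀ y, IsMaxmin G y → ∀ e, z e = 0 → y e = 0

theorem IsMaxmin.nonneg {x : G.edgeSet → ℝ} (hx : IsMaxmin G x) (e : G.edgeSet) : 0 ≤ x e :=
  hx.1.1 e

theorem eq_of_levelPartition_eq (hG : G.Connected) {z y : G.edgeSet → ℝ} (hy : IsMaxmin G y)
    (hz : levelPartition G z = primePartition G) {e f : G.edgeSet} (h : z e = z f) :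
    y e = y f := by
  have h1 := (isPrimePartition_primePartition hG (nonempty_edgeSet_of_isMaxmin hy)).2 y hy
  rw [← hz] at h1
  exact refines_levelPartition_iff.1 h1 e f h

/-- Each pair of edges separated by `x` is merged by at most one `t`, so only finitely many `t` are
excluded. -/
theorem exists_combo_separating (x y : G.edgeSet → ℝ) : ∃ t ∈ Set.Ioo (0 : ℝ) 1,
    ∀ e f, ((1 - t) • x + t • y) e = ((1 - t) • x + t • y) f → x e = x f := by
  let bad : Set ℝ := ⋃ p : G.edgeSet × G.edgeSet,
    {t | x p.1 ≠ x p.2 ∧ (1 - t) * (x p.1 - x p.2) + t * (y p.1 - y p.2) = 0}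
  have hbad : bad.Finite := by
    refine Set.finite_iUnion fun p => Set.Subsingleton.finite ?_
    rintro t ⟨hp, ht⟩ u ⟨-, hu⟩
    have h : (t - u) * (x p.1 - x p.2) = 0 := by
      linear_combination t * hu - u * ht
    exact sub_eq_zero.1 ((mul_eq_zero.1 h).resolve_right (sub_ne_zero.2 hp))
  obtain ⟨t, ht, htb⟩ := ((Set.Ioo_infinite (zero_lt_one (α := ℝ))).sdiff hbad).nonempty
  refine ⟨t, ht, fun e f h => ?_⟩
  by_contra hne
  refine htb (Set.mem_iUnion.2 ⟨(e, f), hne, ?_⟩)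
  simp only [Pi.add_apply, Pi.smul_apply, smul_eq_mul] at h
  linarith

/-- Maximize the support among strategies with the right levels. If some maxmin `y` were positive
where `z` vanishes, a separating mixture would keep the levels and enlarge the support. -/
theorem exists_isPrimeRep (hG : G.Connected) (hE : Nonempty G.edgeSet) :
    ∃ z : G.edgeSet → ℝ, IsPrimeRep z := by
  let supp : (G.edgeSet → ℝ) → Finset G.edgeSet := fun x => univ.filter fun e => 0 < x e
  obtain ⟨⟨x, hx, hxp⟩, -⟩ := isPrimePartition_primePartition hG hE
  obtain ⟨s, ⟨⟨z, ⟨hz, hzp⟩, rfl⟩, hmax⟩⟩ := (Set.toFinite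
    (supp '' {x | IsMaxmin G x ∧ levelPartition G x = primePartition G})).exists_maximal
      ⟨_, x, ⟨hx, hxp⟩, rfl⟩
  refine ⟨z, hz, hzp, fun y hy e he => ?_⟩
  by_contra hne
  obtain ⟨t, ht, hsep⟩ := exists_combo_separating z y
  have hw := hz.combo hG hy ht.1.le ht.2.le
  have hwp : IsPrimePartition G (levelPartition G ((1 - t) • z + t • y)) :=
    ⟨⟨_, hw, rfl⟩, fun u hu => refines_levelPartition_iff.2 fun e f h =>
      eq_of_levelPartition_eq hG hu hzp (hsep e f h)⟩
  have hle : supp z ≤ supp ((1 - t) • z + t • y) := by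
    intro f hf
    simp only [supp, mem_filter, mem_univ, true_and, Pi.add_apply, Pi.smul_apply,
      smul_eq_mul] at hf ⊢
    exact add_pos_of_pos_of_nonneg (mul_pos (sub_pos.2 ht.2) hf)
      (mul_nonneg ht.1.le (hy.nonneg f))
  have hmem : e ∈ supp ((1 - t) • z + t • y) := by
    simp only [supp, mem_filter, mem_univ, true_and, Pi.add_apply, Pi.smul_apply, smul_eq_mul, he,
      mul_zero, zero_add]
    exact mul_pos ht.1 ((hy.nonneg e).lt_of_ne' hne)
  have h := hmax ⟨_, ⟨hw, hwp.unique (isPrimePartition_primePartition hG hE)⟩, rfl⟩ hle hmem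
  simp [supp, he] at h

/-! ### Best responses, optimal subgraphs and the order on parts -/

namespace IsPrimeRep

variable {z : G.edgeSet → ℝ}

theorem mem_primePartition (hz : IsPrimeRep z) {P : Finset G.edgeSet} :
    P ∈ primePartition G ↔ ∃ e, P = levelSet z e := by
  rw [← hz.levelPartition_eq, levelPartition]
  simp only [mem_image, mem_univ, true_and, levelSet, eq_comm]

theorem mem_degenerateSet (hz : IsPrimeRep z) {e : G.edgeSet} :
    e ∈ degenerateSet G ↔ z e = 0 := by
  constructor
  · intro he
    unfold degenerateSet at he
    split_ifs at he with h
    · exact h.choose_spec.2 z hz.isMaxmin e he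
    · simp at he
  · intro he
    have hD : IsDegenerate G (levelSet z e) :=
      ⟨hz.mem_primePartition.2 ⟨e, rfl⟩, fun y hy f hf =>
        hz.eq_zero y hy f ((mem_levelSet.1 hf).trans he)⟩
    have hex : ∃ D, IsDegenerate G D := ⟨_, hD⟩
    rw [degenerateSet, dif_pos hex, hex.choose_spec.unique hD]
    exact mem_levelSet.2 rfl

theorem mem_nondegenerateParts (hz : IsPrimeRep z) {P : Finset G.edgeSet} :
    P ∈ nondegenerateParts G ↔ ∃ e, 0 < z e ∧ P = levelSet z e := by
  rw [nondegenerateParts, mem_erase, hz.mem_primePartition]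
  constructor
  · rintro ⟨hne, e, rfl⟩
    refine ⟨e, (hz.isMaxmin.nonneg e).lt_of_ne' fun he => hne ?_, rfl⟩
    ext f
    rw [mem_levelSet, hz.mem_degenerateSet, he]
  · rintro ⟨e, he, rfl⟩
    refine ⟨fun h => he.ne' ?_, e, rfl⟩
    rw [← hz.mem_degenerateSet, ← h, mem_levelSet]

theorem isOCSG_iff (hz : IsPrimeRep z) {S : Finset G.edgeSet} :
    IsOCSG G S ↔ IsCSG G S ∧ ∀ e, 0 < z e → IsBalanced S (levelSet z e) := by
  simp only [IsOCSG, IsBalanced, hz.mem_nondegenerateParts, mul_comm (opt G)]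
  refine and_congr_right fun _ => ⟨fun h e he => h _ ⟨e, he, rfl⟩, ?_⟩
  rintro h _ ⟨e, he, rfl⟩
  exact h e he

/-- Every maxmin `y` is constant on the parts and zero on the degenerate set, so the balance on each
part fixes the weight at `opt`. -/
theorem mem_bestResponses_of_isOCSG (hG : G.Connected) (hz : IsPrimeRep z) {y : G.edgeSet → ℝ}
    (hy : IsMaxmin G y) {S : Finset G.edgeSet} (hS : IsOCSG G S) : S ∈ bestResponses G y := by
  obtain ⟨hcsg, hbal⟩ := hz.isOCSG_iff.1 hS
  refine mem_bestResponses.2 ⟨hcsg, ?_⟩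
  rw [weight_eq_of_isBalanced hz.isMaxmin.nonneg
    (fun e f => eq_of_levelPartition_eq hG hy hz.levelPartition_eq) (hz.eq_zero y hy) hbal,
    hy.1.2, mul_one, (hy.minWeight_eq_and_isTight hG).1]

theorem mem_bestResponses_iff (hG : G.Connected) (hz : IsPrimeRep z) {S : Finset G.edgeSet} :
    S ∈ bestResponses G z ↔ IsOCSG G S :=
  ⟨fun h => hz.isOCSG_iff.2 ⟨(mem_bestResponses.1 h).1, fun _ he =>
    isBalanced_levelSet hG hz.isMaxmin h he⟩, hz.mem_bestResponses_of_isOCSG hG hz.isMaxmin⟩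

theorem bestResponses_subset (hG : G.Connected) (hz : IsPrimeRep z) {y : G.edgeSet → ℝ}
    (hy : IsMaxmin G y) : bestResponses G z ⊆ bestResponses G y := fun _ hS =>
  hz.mem_bestResponses_of_isOCSG hG hy ((hz.mem_bestResponses_iff hG).1 hS)

theorem isPrimeDist_iff (hG : G.Connected) (hz : IsPrimeRep z) {y : G.edgeSet → ℝ}
    (hy : IsMaxmin G y) : IsPrimeDist G y ↔ bestResponses G y = bestResponses G z := by
  constructor
  · exact fun h => (eq_of_subset_of_card_le (hz.bestResponses_subset hG hy)
      (h.2 z hz.isMaxmin)).symm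
  · refine fun h => ⟨hy, fun u hu => ?_⟩
    rw [h]
    exact card_le_card (hz.bestResponses_subset hG hu)

theorem levelSet_eq_of_mem (hz : IsPrimeRep z) {P : Finset G.edgeSet}
    (hP : P ∈ nondegenerateParts G) {e : G.edgeSet} (he : e ∈ P) :
    P = levelSet z e ∧ 0 < z e := by
  obtain ⟨f, hf, rfl⟩ := hz.mem_nondegenerateParts.1 hP
  rw [mem_levelSet] at he
  exact ⟨by simp [levelSet, he], he ▸ hf⟩

/-- An optimal subgraph is a best response to `y`, so the exchange cannot lower its weight. At
equality the exchanged set would be a best response to `z` too, putting both edges on one level of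
`z`, although the parts differ. With `y = z` this shows that `LeadsTo` is acyclic. -/
theorem lt_of_leadsTo_of_bestResponses_eq (hG : G.Connected) (hz : IsPrimeRep z) {P P' : Finset G.edgeSet}
    (h : LeadsTo G P P') {y : G.edgeSet → ℝ} (hy : IsMaxmin G y)
    (hbr : bestResponses G y = bestResponses G z) {e e' : G.edgeSet} (he : e ∈ P) (he' : e' ∈ P') :
    y e' < y e := by
  obtain ⟨hP, hP', hne, H, hH, f, hf, f', hf', hcsg⟩ := h
  rw [mem_sdiff] at hf
  rw [mem_inter] at hf'
  have hHy := hz.mem_bestResponses_of_isOCSG hG hy hH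
  have hle := le_of_mem_bestResponses hHy hf.2 hf'.2 hcsg
  have hlt : y f' < y f := hle.lt_of_ne' fun heq => by
    have h1 := exchange_mem_bestResponses hHy hf.2 hf'.2 hcsg heq
    have h2 := hz.mem_bestResponses_of_isOCSG hG hz.isMaxmin hH
    rw [hbr, mem_bestResponses, weight_exchange z hf.2 hf'.2, (mem_bestResponses.1 h2).2] at h1
    have h3 : z f = z f' := by linarith [h1.2]
    apply hne
    rw [(hz.levelSet_eq_of_mem hP hf.1).1, (hz.levelSet_eq_of_mem hP' hf'.1).1]
    simp [levelSet, h3]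
  rw [(hz.levelSet_eq_of_mem hP hf.1).1, mem_levelSet] at he
  rw [(hz.levelSet_eq_of_mem hP' hf'.1).1, mem_levelSet] at he'
  rwa [eq_of_levelPartition_eq hG hy hz.levelPartition_eq he,
    eq_of_levelPartition_eq hG hy hz.levelPartition_eq he']

/-- A strategy that decreases from parents to children decreases along the relation `LeadsTo`. -/
theorem lt_of_leadsTo (hG : G.Connected) (hz : IsPrimeRep z) {y : G.edgeSet → ℝ}
    (hy : ∀ P P', IsParent G P P' → ∀ e ∈ P, ∀ e' ∈ P', y e' < y e) {P P' : Finset G.edgeSet}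
    (h : LeadsTo G P P') {e e' : G.edgeSet} (he : e ∈ P) (he' : e' ∈ P') : y e' < y e := by
  -- Since `z` decreases along `LeadsTo`, an intermediate part lies strictly between in `z`, and
  -- both halves have fewer edges in between.
  induction hn : (univ.filter fun f => z e' < z f ∧ z f < z e).card using Nat.strong_induction_on
    generalizing P P' e e' with
  | _ n ih =>
  subst hn
  by_cases hpar : IsParent G P P'
  · exact hy P P' hpar e he e' he'
  · obtain ⟨Q, hQ, hQ'⟩ : ∃ Q, LeadsTo G P Q ∧ LeadsTo G Q P' := by
      by_contra hno
      exact hpar ⟨h, hno⟩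
    obtain ⟨f, -, hfQ⟩ := hz.mem_nondegenerateParts.1 hQ.2.1
    have hf : f ∈ Q := by rw [hfQ, mem_levelSet]
    have h1 := hz.lt_of_leadsTo_of_bestResponses_eq hG hQ hz.isMaxmin rfl he hf
    have h2 := hz.lt_of_leadsTo_of_bestResponses_eq hG hQ' hz.isMaxmin rfl hf he'
    refine (ih _ (card_lt_card ?_) hQ' hf he' rfl).trans (ih _ (card_lt_card ?_) hQ he hf rfl)
    · refine (ssubset_iff_of_subset fun g hg => ?_).2 ⟨f, by simp [h1, h2], by simp⟩
      simp only [mem_filter, mem_univ, true_and] at hg ⊢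
      exact ⟨hg.1, hg.2.trans h1⟩
    · refine (ssubset_iff_of_subset fun g hg => ?_).2 ⟨f, by simp [h1, h2], by simp⟩
      simp only [mem_filter, mem_univ, true_and] at hg ⊢
      exact ⟨h2.trans hg.1, hg.2⟩

/-- A union of nondegenerate parts that no outside part leads into is tight. -/
theorem isTight_of_not_leadsTo (hG : G.Connected) (hz : IsPrimeRep z) {A : Finset G.edgeSet}
    (hpos : ∀ e ∈ A, 0 < z e) (hlevel : ∀ e f, z e = z f → (e ∈ A ↔ f ∈ A))
    (h : ∀ e ∉ A, ∀ e' ∈ A, ¬ LeadsTo G (levelSet z e) (levelSet z e')) : IsTight G A := by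
  intro S hS
  by_contra! hlt
  obtain ⟨T, hT, hmin⟩ := exists_isMinimalCSG_mem_bestResponses hG hz.isMaxmin.nonneg
  have hTo := (hz.mem_bestResponses_iff hG).1 hT
  have hbal : ((T ∩ A).card : ℝ) = opt G * A.card := by
    have h1 := weight_eq_of_isBalanced (y := fun e => if e ∈ A then 1 else 0)
      hz.isMaxmin.nonneg (fun e f hef => by simp only [hlevel e f hef])
      (fun e he => if_neg fun hA => (hpos e hA).ne' he) (hz.isOCSG_iff.1 hTo).2
    rw [weight_ite_mem] at h1
    simpa using h1
  have hcard : (S ∩ A).card < (T ∩ A).card := by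
    rw [← hbal] at hlt
    exact_mod_cast hlt
  have hS' := hS.numComponents_le A
  obtain ⟨e, he, heT, e', he', hcsg⟩ := hmin.exists_exchange (A := A) (by omega)
  rw [mem_inter] at he'
  have hz' := hpos e' he'.2
  -- This gives `z e ≥ z e' > 0`, so the part of `e` is nondegenerate and leads into `A`.
  have hle := le_of_mem_bestResponses hT heT he'.1 hcsg
  refine h e he e' he'.2 ⟨hz.mem_nondegenerateParts.2 ⟨e, hz'.trans_le hle, rfl⟩,
    hz.mem_nondegenerateParts.2 ⟨e', hz', rfl⟩, fun heq => he ?_, T, hTo, e, ?_, e', ?_, hcsg⟩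
  · have : e ∈ levelSet z e' := heq ▸ mem_levelSet.2 rfl
    exact (hlevel e e' (mem_levelSet.1 this)).2 he'.2
  · exact mem_sdiff.2 ⟨mem_levelSet.2 rfl, heT⟩
  · exact mem_inter.2 ⟨mem_levelSet.2 rfl, he'.1⟩

theorem isOCSG_of_mem_bestResponses (hG : G.Connected) (hz : IsPrimeRep z) {y : G.edgeSet → ℝ}
    (hy : IsMaxmin G y) (hpos : ∀ e, e ∉ degenerateSet G → 0 < y e)
    (hpar : ∀ P P', IsParent G P P' → ∀ e ∈ P, ∀ e' ∈ P', y e' < y e) {S : Finset G.edgeSet}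
    (hS : S ∈ bestResponses G y) : IsOCSG G S := by
  have hcsg := (mem_bestResponses.1 hS).1
  refine hz.isOCSG_iff.2 ⟨hcsg, fun e he => ?_⟩
  have hye : 0 < y e := hpos e fun hD => he.ne' (hz.mem_degenerateSet.1 hD)
  have hyz : ∀ {f g}, z f = z g → y f = y g :=
    eq_of_levelPartition_eq hG hy hz.levelPartition_eq
  -- A part leading into `A` has a `y`-value above `y e`, so it already lies in `A`.
  have htight : ∀ A : Finset G.edgeSet, (∀ f, y e < y f → f ∈ A) → (∀ f ∈ A, y e ≤ y f) →
      (∀ f g, z f = z g → (f ∈ A ↔ g ∈ A)) → opt G * A.card ≤ (S ∩ A).card := by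
    intro A h1 h2 h3
    refine hz.isTight_of_not_leadsTo hG (fun f hf => ?_) h3 (fun f hf g hg hfg => ?_) S hcsg
    · refine (hz.isMaxmin.nonneg f).lt_of_ne' fun h0 => ?_
      linarith [h2 f hf, hz.eq_zero y hy f h0]
    · have h4 := hz.lt_of_leadsTo hG hpar hfg (mem_levelSet.2 rfl) (mem_levelSet.2 rfl)
      exact hf (h1 f ((h2 g hg).trans_lt h4))
  set U := univ.filter fun f => y e < y f with hU
  set W := univ.filter fun f => y e ≤ y f with hW
  set P := levelSet z e with hPdef
  have hUbal : IsBalanced S U := isBalanced_strict_superlevel hG hy hS hye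
  have hWbal : IsBalanced S W := isBalanced_superlevel hG hy hS hye
  have hPe : ∀ f ∈ P, y f = y e := fun f hf => hyz (mem_levelSet.1 hf)
  have hPW : P ⊆ W := fun f hf => by simp [hW, hPe f hf]
  have hdisj : Disjoint U P := disjoint_left.2 fun f hf hfP => by
    simp [hU, hPe f hfP] at hf
  -- As `U` is balanced, tightness of `U ∪ P` bounds `|S ∩ P|` from below. As `W` is balanced,
  -- tightness of `W \ P` bounds it from above.
  have h1 := htight (U ∪ P) (fun f hf => mem_union_left _ (by simpa [hU] using hf))
    (fun f hf => by
      rcases mem_union.1 hf with hf | hf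
      · exact (mem_filter.1 hf).2.le
      · exact (hPe f hf).ge)
    (fun f g hfg => by simp [hU, hPdef, mem_levelSet, hfg, hyz hfg])
  have h2 := htight (W \ P)
    (fun f hf => mem_sdiff.2 ⟨by simpa [hW] using hf.le, fun hfP => hf.ne' (hPe f hfP)⟩)
    (fun f hf => (mem_filter.1 (mem_sdiff.1 hf).1).2)
    (fun f g hfg => by simp [hW, hPdef, mem_levelSet, hfg, hyz hfg])
  have h3 := card_union_of_disjoint hdisj
  have h4 : (S ∩ (U ∪ P)).card = (S ∩ U).card + (S ∩ P).card := by
    rw [inter_union_distrib_left, card_union_of_disjoint]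
    exact hdisj.mono inter_subset_right inter_subset_right
  have h5 := card_sdiff_add_card_eq_card hPW
  have h6 : (S ∩ (W \ P)).card + (S ∩ P).card = (S ∩ W).card := by
    rw [← card_union_of_disjoint, ← inter_union_distrib_left, sdiff_union_of_subset hPW]
    exact sdiff_disjoint.mono inter_subset_right inter_subset_right
  rw [IsBalanced] at hUbal hWbal ⊢
  rw [h3, h4] at h1
  rw [← h5, ← h6] at hWbal
  push_cast at h1 h2 hWbal
  linarith

theorem pos_of_bestResponses_eq (hG : G.Connected) (hz : IsPrimeRep z) {y : G.edgeSet → ℝ}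
    (hy : IsMaxmin G y) (hopt : opt G < 1) (hbr : bestResponses G y = bestResponses G z)
    {e : G.edgeSet} (he : e ∉ degenerateSet G) : 0 < y e := by
  refine (hy.nonneg e).lt_of_ne' fun h0 => ?_
  have hze : 0 < z e := (hz.isMaxmin.nonneg e).lt_of_ne' fun h =>
    he (hz.mem_degenerateSet.2 h)
  obtain ⟨H, hH⟩ := bestResponses_nonempty hG z
  have hbal : IsBalanced H (levelSet z e) := isBalanced_levelSet hG hz.isMaxmin hH hze
  -- A balanced `H` cannot contain the whole part, since `opt < 1`.
  obtain ⟨f, hf, hfH⟩ : ∃ f ∈ levelSet z e, f ∉ H := by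
    by_contra! hsub
    rw [IsBalanced, inter_eq_right.2 hsub] at hbal
    have : (0 : ℝ) < (levelSet z e).card := by
      exact_mod_cast card_pos.2 ⟨e, mem_levelSet.2 rfl⟩
    nlinarith
  have hzf : z f = z e := mem_levelSet.1 hf
  have hyf : y f = 0 := (eq_of_levelPartition_eq hG hy hz.levelPartition_eq hzf).trans h0
  have hHy := hz.bestResponses_subset hG hy hH
  -- Adding `f` costs nothing under `y`, but a positive amount under `z`.
  have h1 : insert f H ∈ bestResponses G y := by
    refine mem_bestResponses.2 ⟨(mem_bestResponses.1 hHy).1.mono (subset_insert _ _), ?_⟩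
    rw [← (mem_bestResponses.1 hHy).2, weight, sum_insert hfH, hyf, zero_add, weight]
  rw [hbr, mem_bestResponses, ← (mem_bestResponses.1 hH).2, weight, sum_insert hfH, weight] at h1
  linarith [h1.2]

end IsPrimeRep

end PrimePartition

end WiretapGame

open WiretapGame in
theorem mainTheorem7 {V : Type*} [Fintype V] [DecidableEq V] (G : SimpleGraph V)
    [DecidableRel G.Adj] (hG : G.Connected) (γ : G.edgeSet → ℝ) (hγ : IsMaxmin G γ) :
    (((∀ e, e ∉ degenerateSet G → 0 < γ e) ∧
        ∀ P P', IsParent G P P' → ∀ e ∈ P, ∀ e' ∈ P', γ e' < γ e) → IsPrimeDist G γ) ∧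
    (opt G < 1 → IsPrimeDist G γ →
      (∀ e, e ∉ degenerateSet G → 0 < γ e) ∧
        ∀ P P', IsParent G P P' → ∀ e ∈ P, ∀ e' ∈ P', γ e' < γ e) ∧
    (IsPrimeDist G γ → ∀ S, S ∈ bestResponses G γ ↔ IsOCSG G S) := by
  obtain ⟨z, hz⟩ := exists_isPrimeRep hG (nonempty_edgeSet_of_isMaxmin hγ)
  rw [hz.isPrimeDist_iff hG hγ]
  refine ⟨fun h => ?_, fun hopt hbr => ⟨fun e he => hz.pos_of_bestResponses_eq hG hγ hopt hbr he,
    fun P P' hP e he e' he' => hz.lt_of_leadsTo_of_bestResponses_eq hG hP.1 hγ hbr he he'⟩, fun hbr S => ?_⟩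
  · exact Finset.Subset.antisymm (fun S hS => (hz.mem_bestResponses_iff hG).2
      (hz.isOCSG_of_mem_bestResponses hG hγ h.1 h.2 hS)) (hz.bestResponses_subset hG hγ)
  · rw [hbr, hz.mem_bestResponses_iff hG]
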